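/- Let $d\ge 0$, let $\mathcal X\subset\{0,1\}^d$ be a finite set of arms and, for $\theta\in\mathbb R^d$, consider the combinatorial semi-bandit with Gaussian noise: in each round $t$ a vector $Z^{(t)}\sim\mathcal N(\theta,I)$ is drawn, independently over rounds, and a learner who pulls $x\in\mathcal X$ observes $Z^{(t)}_j$ for exactly those $j$ with $x_j=1$. A (possibly randomized) best-arm-identification algorithm chooses each pull, decides when to stop, and returns an arm when it stops, always on the basis of its past observations and of internal randomness independent of $(Z^{(t)})_t$. Let $T\in\{0,1,2,\dots\}\cup\{\infty\}$ be its total number of pulls. For $\delta\in(0,1)$ it is called $\delta$-PAC if for every $\theta\in\mathbb R^d$ for which $\arg\max_{x\in\mathcal X}\theta^\top x$ is unique, it stops and returns this arm with probability at least $1-\delta$. **Theorem.** Let $\theta_*\in\mathbb R^d$ be such that $x_*=\arg\max_{x\in\mathcal X}\theta_*^\top x$ is unique, let $\delta\in(0,1)$, and let $T$ be the total number of pulls of a $\delta$-PAC algorithm on the instance $(\mathcal X,\theta_*)$. Then $$\mathbb E_{\theta_*}[T]\;\ge\;\log\!\Big(\frac{1}{2.4\,\delta}\Big)\,\rho^*,\qquad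 \rho^*:=\inf_{\lambda\in\triangle_{\mathcal X}}\ \max_{x\in\mathcal X\setminus\{x_*\}}\frac{\|x_*-x\|^2_{A_{\mathrm{semi}}(\lambda)^{-1}}}{\big(\theta_*^\top(x_*-x)\big)^2}.$$ Here $\triangle_{\mathcal X}$ is the set of probability vectors $(\lambda_x)_{x\in\mathcal X}$, $A_{\mathrm{semi}}(\lambda)$ is the diagonal matrix with the same diagonal as $\sum_{x\in\mathcal X}\lambda_x xx^\top$, and $\|v\|^2_{A^{-1}}=v^\top A^{-1}v=\sum_i v_i^2/A_{ii}$, where $0/0=0$ and $a/0=\infty$ for $a>0$; the maximum over the empty set (the case $\mathcal X=\{x_*\}$) is $0$. -/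

import Mathlib

open MeasureTheory ProbabilityTheory
open scoped ENNReal

universe u

noncomputable section

/-- `x` is the unique element of `𝒳` with the largest mean reward `θᵀ x`. -/
def IsUniqueBestArm {d : ℕ} (𝒳 : Finset (Fin d → ℝ)) (θ : Fin d → ℝ) (x : Fin d → ℝ) : Prop :=
  x ∈ 𝒳 ∧ ∀ y ∈ 𝒳, y ≠ x → θ ⬝ᵥ y < θ ⬝ᵥ x

/-- Semi-bandit feedback: on pulling `x ∈ {0,1}^d` while the noisy vector of the round is `z`,
the coordinates `z j` with `x j = 1` are revealed, and the other ones are reported as `0`. -/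
def semiFeedback {d : ℕ} (x z : Fin d → ℝ) : Fin d → ℝ :=
  open Classical in fun j => if x j = 1 then z j else 0

/-- The arms pulled and the feedback received in the first `t` rounds. -/
abbrev SemiBanditHistory {d : ℕ} (𝒳 : Finset (Fin d → ℝ)) (t : ℕ) : Type :=
  Fin t → 𝒳 × (Fin d → ℝ)

/-- A (randomized) best-arm-identification algorithm on the arm set `𝒳`: it draws an internal
random seed and then, as measurable functions of the seed and of the history of the first `t`
rounds, decides whether to stop after `t` pulls, which arm to pull next if it goes on, and which
arm to return if it stops. -/
structure SemiBanditAlgorithm {d : ℕ} (𝒳 : Finset (Fin d → ℝ)) where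
  Seed : Type u
  seedSpace : MeasurableSpace Seed
  seedLaw : Measure Seed
  seedLaw_prob : IsProbabilityMeasure seedLaw
  pull : (t : ℕ) → Seed × SemiBanditHistory 𝒳 t → 𝒳
  measurable_pull : ∀ t, Measurable (pull t)
  stopSet : (t : ℕ) → Set (Seed × SemiBanditHistory 𝒳 t)
  measurableSet_stopSet : ∀ t, MeasurableSet (stopSet t)
  answer : (t : ℕ) → Seed × SemiBanditHistory 𝒳 t → 𝒳
  measurable_answer : ∀ t, Measurable (answer t)

attribute [instance] SemiBanditAlgorithm.seedSpace SemiBanditAlgorithm.seedLaw_prob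

namespace SemiBanditAlgorithm

variable {d : ℕ} {𝒳 : Finset (Fin d → ℝ)}

/-- Outcomes: the internal seed and the sequence of the noisy vectors of all rounds. -/
abbrev Outcome (A : SemiBanditAlgorithm.{u} 𝒳) : Type _ := A.Seed × (ℕ → Fin d → ℝ)

/-- The law of the outcome under the parameter `θ`: the noisy vectors of the rounds are independent
with law `N(θ, I)`, and independent of the seed. -/
def law (A : SemiBanditAlgorithm.{u} 𝒳) (θ : Fin d → ℝ) : Measure A.Outcome :=
  A.seedLaw.prod
    (Measure.infinitePi fun _ : ℕ => Measure.pi fun i : Fin d => gaussianReal (θ i) 1)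

/-- The history of the first `t` rounds (if the algorithm is run that long). -/
def history (A : SemiBanditAlgorithm.{u} 𝒳) (ω : A.Outcome) : (t : ℕ) → SemiBanditHistory 𝒳 t
  | 0 => Fin.elim0
  | t + 1 =>
    Fin.snoc (α := fun _ => 𝒳 × (Fin d → ℝ)) (A.history ω t)
      (A.pull t (ω.1, A.history ω t),
        semiFeedback (A.pull t (ω.1, A.history ω t) : Fin d → ℝ) (ω.2 t))

/-- The total number of pulls `T`: the first `t` at which the algorithm stops (`⊤` if it never
does). -/
def numPulls (A : SemiBanditAlgorithm.{u} 𝒳) (ω : A.Outcome) : ℕ∞ :=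
  ⨅ (t : ℕ) (_ : (ω.1, A.history ω t) ∈ A.stopSet t), (t : ℕ∞)

/-- The event that the algorithm stops and returns `x`. -/
def returns (A : SemiBanditAlgorithm.{u} 𝒳) (x : Fin d → ℝ) : Set A.Outcome :=
  {ω | ∃ t : ℕ, A.numPulls ω = t ∧ (A.answer t (ω.1, A.history ω t) : Fin d → ℝ) = x}

/-- `δ`-PAC: for every parameter `θ ∈ ℝ^d` with a unique best arm, that arm is returned with
probability at least `1 - δ`. -/
def IsPAC (A : SemiBanditAlgorithm.{u} 𝒳) (δ : ℝ) : Prop :=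
  ∀ θ x : Fin d → ℝ, IsUniqueBestArm 𝒳 θ x → ENNReal.ofReal (1 - δ) ≤ A.law θ (A.returns x)

end SemiBanditAlgorithm

/-- `A_semi(λ) = diag (∑_x λ_x x xᵀ)`, all the off-diagonal entries being set to zero. -/
def Asemi {d : ℕ} (𝒳 : Finset (Fin d → ℝ)) (w : 𝒳 → ℝ) : Matrix (Fin d) (Fin d) ℝ :=
  Matrix.diagonal (Matrix.diag
    (∑ x : 𝒳, w x • Matrix.vecMulVec (x : Fin d → ℝ) (x : Fin d → ℝ)))

/-- `‖v‖²_{A⁻¹} = vᵀ A⁻¹ v` for a diagonal matrix `A` with non-negative entries, with the usual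
extension to singular `A`: a coordinate with `A i i = 0` contributes `∞` if `v i ≠ 0`, and `0` if
`v i = 0` (in `ℝ≥0∞`, `a / 0 = ∞` for `a ≠ 0` and `0 / 0 = 0`). -/
def invNormSq {d : ℕ} (A : Matrix (Fin d) (Fin d) ℝ) (v : Fin d → ℝ) : ℝ≥0∞ :=
  ∑ i, ENNReal.ofReal (v i ^ 2) / ENNReal.ofReal (A i i)

/-- For an invertible diagonal matrix this is the usual quadratic form of the inverse. -/
theorem invNormSq_diagonal {d : ℕ} (a v : Fin d → ℝ) (ha : ∀ i, 0 < a i) :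
    invNormSq (Matrix.diagonal a) v =
      ENNReal.ofReal (v ⬝ᵥ Matrix.mulVec (Matrix.diagonal a)⁻¹ v) := by
  have hinv : (Matrix.diagonal a)⁻¹ = Matrix.diagonal fun i => (a i)⁻¹ := by
    apply Matrix.inv_eq_right_inv
    rw [Matrix.diagonal_mul_diagonal, ← Matrix.diagonal_one]
    congr 1
    funext i
    exact mul_inv_cancel₀ (ha i).ne'
  rw [hinv, invNormSq, dotProduct, ENNReal.ofReal_sum_of_nonneg]
  · refine Finset.sum_congr rfl fun i _ => ?_
    rw [Matrix.diagonal_apply_eq, ← ENNReal.ofReal_div_of_pos (ha i), Matrix.mulVec_diagonal]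
    congr 1
    ring
  · intro i _
    rw [Matrix.mulVec_diagonal]
    have := (inv_pos.2 (ha i)).le
    nlinarith [mul_nonneg this (sq_nonneg (v i))]

/-- `ρ* = inf_λ sup_{x ≠ x*} ‖x* - x‖²_{A_semi(λ)⁻¹} / (θᵀ (x* - x))²`, with `λ` ranging over the
probability vectors on `𝒳`. -/
def rhoStar {d : ℕ} (𝒳 : Finset (Fin d → ℝ)) (θ xs : Fin d → ℝ) : ℝ≥0∞ :=
  ⨅ w ∈ stdSimplex ℝ 𝒳, ⨆ x ∈ 𝒳, ⨆ _ : x ≠ xs,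
    invNormSq (Asemi 𝒳 w) (xs - x) / ENNReal.ofReal ((θ ⬝ᵥ (xs - x)) ^ 2)

end

/-! An algorithm that is right under both `θ` and an alternative `θ'` with another best arm must
collect enough information to tell them apart. The information is the expected log-likelihood ratio
up to stopping. By a Wald-type identity it equals `∑ j, a j * (θ' j - θ j)² / 2`, where `a j` is the
expected number of observations of coordinate `j` under `θ` (`integral_stoppedLogRatio`,
`sum_expectedPulls_mul_semiDivergence`). Testing the return of `xs` bounds it below by `K = (1 - 2δ)
log((1 - δ)/δ)`, the relative entropy of Bernoulli(`1 - δ`) and Bernoulli(`δ`)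
(`two_point_transportation`, `transportation`).

For a competitor `x` and `v = xs - x`, the cheapest `θ'` with `θ' ⬝ᵥ v ≤ 0` costs `(θ ⬝ᵥ v)² / (2 ∑
j, v j² / a j)`, so `2K ∑ j, v j² / a j ≤ (θ ⬝ᵥ v)²` (`diagonal_cost_lower_bound`). The normalized
expected pull counts form a probability vector whose `Asemi` has diagonal `a / E[T]`; as a candidate
in the infimum it gives `2K ρ* ≤ E[T]`. Finally `2K ≥ log(1/(2.4δ))`, where the factor 2 from the
Gaussian cost leaves room to spare. -/

/-! ### Densities of products and of Gaussian shifts. -/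

theorem MeasureTheory.Measure.pi_withDensity {ι : Type*} [Fintype ι] {α : ι → Type*}
    [∀ i, MeasurableSpace (α i)] (μ : ∀ i, Measure (α i)) [∀ i, IsProbabilityMeasure (μ i)]
    (f : ∀ i, α i → ℝ≥0∞) (hf : ∀ i, Measurable (f i))
    [∀ i, SigmaFinite ((μ i).withDensity (f i))] :
    Measure.pi (fun i => (μ i).withDensity (f i)) =
      (Measure.pi μ).withDensity fun z => ∏ i, f i (z i) := by
  refine Measure.pi_eq fun s hs => ?_
  have hm : ∀ i, Measurable ((s i).indicator (f i)) := fun i => (hf i).indicator (hs i)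
  have hind : iIndepFun (fun i (z : ∀ i, α i) => (s i).indicator (f i) (z i)) (Measure.pi μ) :=
    iIndepFun_pi fun i => (hm i).aemeasurable
  rw [withDensity_apply _ (MeasurableSet.univ_pi hs),
    ← lintegral_indicator (MeasurableSet.univ_pi hs)]
  have hprod : ∀ z : ∀ i, α i, (Set.univ.pi s).indicator (fun z => ∏ i, f i (z i)) z =
      ∏ i, (s i).indicator (f i) (z i) := by
    intro z
    by_cases hz : z ∈ Set.univ.pi s
    · rw [Set.indicator_of_mem hz]
      exact Finset.prod_congr rfl fun i _ => (Set.indicator_of_mem (hz i (Set.mem_univ i)) _).symm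
    · rw [Set.indicator_of_notMem hz]
      simp only [Set.mem_pi, Set.mem_univ, true_implies, not_forall] at hz
      obtain ⟨i, hi⟩ := hz
      exact (Finset.prod_eq_zero (Finset.mem_univ i) (Set.indicator_of_notMem hi _)).symm
  simp_rw [hprod]
  rw [lintegral_prod_eq_prod_lintegral_of_indepFun Finset.univ _ hind
    fun i => (hm i).comp (measurable_pi_apply i)]
  refine Finset.prod_congr rfl fun i _ => ?_
  rw [(measurePreserving_eval μ i).lintegral_comp (hm i), lintegral_indicator (hs i),
    withDensity_apply _ (hs i)]

theorem gaussianReal_one_eq_withDensity (a b : ℝ) :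
    gaussianReal b 1 = (gaussianReal a 1).withDensity
      fun z => ENNReal.ofReal (Real.exp ((b - a) * z - (b ^ 2 - a ^ 2) / 2)) := by
  rw [gaussianReal_of_var_ne_zero _ one_ne_zero, gaussianReal_of_var_ne_zero _ one_ne_zero,
    ← withDensity_mul _ (measurable_gaussianPDF _ _) (by fun_prop)]
  congr 1
  funext z
  simp only [Pi.mul_apply, gaussianPDF, gaussianPDFReal]
  rw [← ENNReal.ofReal_mul (by positivity), mul_assoc (_⁻¹), ← Real.exp_add]
  congr 3
  push_cast
  ring

/-! ### Likelihood ratio and divergence of the feedback of one pull. -/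

/-- The Gaussian law `N(θ, I)` on `ℝ^d`. -/
noncomputable abbrev gaussianVec {d : ℕ} (θ : Fin d → ℝ) : Measure (Fin d → ℝ) :=
  Measure.pi fun i => gaussianReal (θ i) 1

/-- The log-likelihood ratio of `N(θ', I)` and `N(θ, I)` for the coordinates `j` with `x j = 1`. -/
noncomputable def semiLogRatio {d : ℕ} (θ θ' x z : Fin d → ℝ) : ℝ :=
  open Classical in
  ∑ j, if x j = 1 then (θ' j - θ j) * z j - (θ' j ^ 2 - θ j ^ 2) / 2 else 0

/-- The relative entropy of the marginals of `N(θ, I)` and `N(θ', I)` on the coordinates `j` with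
`x j = 1`. -/
noncomputable def semiDivergence {d : ℕ} (θ θ' x : Fin d → ℝ) : ℝ :=
  open Classical in ∑ j, if x j = 1 then (θ' j - θ j) ^ 2 / 2 else 0

theorem semiDivergence_nonneg {d : ℕ} (θ θ' x : Fin d → ℝ) : 0 ≤ semiDivergence θ θ' x :=
  Finset.sum_nonneg fun j _ => by split_ifs <;> positivity

/-- Hidden coordinates do not enter the ratio, so the likelihood ratio can be computed from the
history alone. -/
theorem semiLogRatio_semiFeedback {d : ℕ} (θ θ' x z : Fin d → ℝ) :
    semiLogRatio θ θ' x (semiFeedback x z) = semiLogRatio θ θ' x z := by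
  unfold semiLogRatio semiFeedback
  refine Finset.sum_congr rfl fun j _ => ?_
  split_ifs <;> rfl

theorem measurable_semiFeedback {d : ℕ} :
    Measurable fun p : (Fin d → ℝ) × (Fin d → ℝ) => semiFeedback p.1 p.2 := by
  classical
  refine measurable_pi_iff.2 fun j => ?_
  unfold semiFeedback
  refine Measurable.ite ?_ (by fun_prop) measurable_const
  exact (measurableSet_singleton (1 : ℝ)).preimage
    ((measurable_pi_apply j).comp measurable_fst)

theorem measurable_semiLogRatio {d : ℕ} (θ θ' : Fin d → ℝ) :
    Measurable fun p : (Fin d → ℝ) × (Fin d → ℝ) => semiLogRatio θ θ' p.1 p.2 := by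
  classical
  unfold semiLogRatio
  refine Finset.measurable_sum _ fun j _ => ?_
  refine Measurable.ite ?_ (by fun_prop) measurable_const
  exact (measurableSet_singleton (1 : ℝ)).preimage
    ((measurable_pi_apply j).comp measurable_fst)

/-- Change of measure for the feedback of a single pull. -/
theorem lintegral_semiFeedback_gaussianVec {d : ℕ} (θ θ' x : Fin d → ℝ)
    {f : (Fin d → ℝ) → ℝ≥0∞} (hf : Measurable f) :
    ∫⁻ z, f (semiFeedback x z) ∂gaussianVec θ' =
      ∫⁻ z, f (semiFeedback x z) * ENNReal.ofReal (Real.exp (semiLogRatio θ θ' x z))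
        ∂gaussianVec θ := by
  classical
  -- The feedback cannot distinguish `θ'` from the hybrid `η`, and the density of `N(η, I)` with
  -- respect to `N(θ, I)` involves the observed coordinates only.
  set η : Fin d → ℝ := fun j => if x j = 1 then θ' j else θ j with hη
  have hm : Measurable (semiFeedback x) :=
    measurable_semiFeedback.comp (measurable_const.prodMk measurable_id)
  have hcoord : ∀ j, Measurable fun r : ℝ => if x j = 1 then r else 0 := fun j => by
    split_ifs <;> fun_prop
  have hmap : ∀ ξ : Fin d → ℝ, (gaussianVec ξ).map (semiFeedback x) =
      Measure.pi fun j => (gaussianReal (ξ j) 1).map fun r => if x j = 1 then r else 0 := by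
    intro ξ
    have : ∀ j, IsProbabilityMeasure
        ((gaussianReal (ξ j) 1).map fun r => if x j = 1 then r else 0) :=
      fun j => Measure.isProbabilityMeasure_map (hcoord j).aemeasurable
    exact Measure.pi_map_pi fun j => (hcoord j).aemeasurable
  have h1 : (gaussianVec θ').map (semiFeedback x) = (gaussianVec η).map (semiFeedback x) := by
    rw [hmap, hmap]
    congr 1
    funext j
    by_cases hj : x j = 1
    · simp [hη, hj]
    · simp [hj]
  have h2 : gaussianVec η = (gaussianVec θ).withDensity
      fun z => ENNReal.ofReal (Real.exp (semiLogRatio θ θ' x z)) := by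
    have hη1 : ∀ j, gaussianReal (η j) 1 = (gaussianReal (θ j) 1).withDensity fun z =>
        ENNReal.ofReal (Real.exp ((η j - θ j) * z - (η j ^ 2 - θ j ^ 2) / 2)) :=
      fun j => gaussianReal_one_eq_withDensity _ _
    have : ∀ j, SigmaFinite ((gaussianReal (θ j) 1).withDensity fun z =>
        ENNReal.ofReal (Real.exp ((η j - θ j) * z - (η j ^ 2 - θ j ^ 2) / 2))) := fun j => by
      rw [← hη1 j]; infer_instance
    rw [gaussianVec, funext hη1, Measure.pi_withDensity _ _ fun j => by fun_prop]
    congr 1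
    funext z
    rw [semiLogRatio, Real.exp_sum, ENNReal.ofReal_prod_of_nonneg fun _ _ => (Real.exp_pos _).le]
    refine Finset.prod_congr rfl fun j _ => ?_
    by_cases hj : x j = 1 <;> simp [hη, hj]
  have hL : Measurable fun z => ENNReal.ofReal (Real.exp (semiLogRatio θ θ' x z)) :=
    (((measurable_semiLogRatio θ θ').comp
      (measurable_const.prodMk measurable_id)).exp).ennreal_ofReal
  rw [← lintegral_map hf hm, h1, lintegral_map hf hm, h2,
    lintegral_withDensity_eq_lintegral_mul _ hL (g := fun z => f (semiFeedback x z)) (hf.comp hm)]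
  exact lintegral_congr fun z => mul_comm _ _

theorem integrable_eval_gaussianVec {d : ℕ} (θ : Fin d → ℝ) (j : Fin d) :
    Integrable (fun z : Fin d → ℝ => z j) (gaussianVec θ) := by
  have : Integrable (id : ℝ → ℝ) (gaussianReal (θ j) 1) :=
    memLp_one_iff_integrable.1 (memLp_id_gaussianReal' 1 (by simp))
  exact (measurePreserving_eval (fun i => gaussianReal (θ i) 1) j).integrable_comp_of_integrable this

theorem integral_eval_gaussianVec {d : ℕ} (θ : Fin d → ℝ) (j : Fin d) :
    ∫ z, z j ∂gaussianVec θ = θ j := by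
  have h := integral_map (μ := gaussianVec θ) (φ := fun z : Fin d → ℝ => z j) (f := fun r : ℝ => r)
    (measurable_pi_apply j).aemeasurable (by fun_prop)
  rw [← h, (measurePreserving_eval (fun i => gaussianReal (θ i) 1) j).map_eq,
    integral_id_gaussianReal]

theorem integrable_semiLogRatio {d : ℕ} (θ θ' x : Fin d → ℝ) :
    Integrable (semiLogRatio θ θ' x) (gaussianVec θ) := by
  unfold semiLogRatio
  refine integrable_finsetSum _ fun j _ => ?_
  split_ifs
  · exact ((integrable_eval_gaussianVec θ j).const_mul _).sub (integrable_const _)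
  · exact integrable_zero _ _ _

theorem integral_semiLogRatio {d : ℕ} (θ θ' x : Fin d → ℝ) :
    ∫ z, semiLogRatio θ θ' x z ∂gaussianVec θ = -semiDivergence θ θ' x := by
  unfold semiLogRatio semiDivergence
  rw [integral_finsetSum, ← Finset.sum_neg_distrib]
  · refine Finset.sum_congr rfl fun j _ => ?_
    split_ifs
    · rw [integral_sub ((integrable_eval_gaussianVec θ j).const_mul _) (integrable_const _),
        integral_const_mul, integral_eval_gaussianVec]
      simp
      ring
    · simp
  · intro j _
    split_ifs
    · exact ((integrable_eval_gaussianVec θ j).const_mul _).sub (integrable_const _)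
    · exact integrable_zero _ _ _

/-! ### Resampling one coordinate of an i.i.d. sequence. -/

theorem measurable_update_prod {ι X : Type*} [DecidableEq ι] [MeasurableSpace X] (n : ι) :
    Measurable fun p : (ι → X) × X => Function.update p.1 n p.2 := by
  refine measurable_pi_iff.2 fun i => ?_
  by_cases hi : i = n
  · subst hi
    simpa using measurable_snd
  · simp only [Function.update_of_ne hi]
    exact (measurable_pi_apply i).comp measurable_fst

theorem MeasureTheory.Measure.map_update_infinitePi {ι X : Type*} [DecidableEq ι]
    [MeasurableSpace X] (μ : Measure X) [IsProbabilityMeasure μ] (n : ι) :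
    ((Measure.infinitePi fun _ : ι => μ).prod μ).map (fun p => Function.update p.1 n p.2) =
      Measure.infinitePi fun _ : ι => μ := by
  have hm := measurable_update_prod (X := X) n
  refine Measure.eq_infinitePi _ fun s t ht => ?_
  rw [Measure.map_apply hm (MeasurableSet.pi s.countable_toSet fun i _ => ht i)]
  have hpre : (fun p : (ι → X) × X => Function.update p.1 n p.2) ⁻¹' Set.pi s t =
      (Set.pi (s.erase n : Finset ι) t) ×ˢ (if n ∈ s then t n else Set.univ) := by
    ext ⟨ζ, z⟩
    simp only [Set.mem_preimage, Set.mem_pi, Finset.mem_coe, Set.mem_prod, Finset.mem_erase]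
    constructor
    · intro h
      refine ⟨fun i hi => by simpa [hi.1] using h i hi.2, ?_⟩
      split_ifs with hn
      · simpa using h n hn
      · trivial
    · rintro ⟨h1, h2⟩ i hi
      by_cases hin : i = n
      · subst hin
        simpa [hi] using h2
      · simpa [hin] using h1 i ⟨hin, hi⟩
  rw [hpre, Measure.prod_prod, Measure.infinitePi_pi _ fun i _ => ht i]
  split_ifs with hn
  · rw [Finset.prod_erase_mul _ _ hn]
  · rw [Finset.erase_eq_of_notMem hn, measure_univ, mul_one]

theorem measurable_fin_snoc {α : Type*} [MeasurableSpace α] (n : ℕ) :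
    Measurable fun p : (Fin n → α) × α => (Fin.snoc p.1 p.2 : Fin (n + 1) → α) := by
  refine measurable_pi_iff.2 fun i => ?_
  induction i using Fin.lastCases with
  | last => simpa using measurable_snd
  | cast i =>
    simp only [Fin.snoc_castSucc]
    exact (measurable_pi_apply i).comp measurable_fst

/-! ### Independence of each round from the past, and change of measure at a fixed time. -/

namespace SemiBanditAlgorithm

variable {d : ℕ} {𝒳 : Finset (Fin d → ℝ)} (A : SemiBanditAlgorithm.{u} 𝒳)

instance isProbabilityMeasure_law (θ : Fin d → ℝ) : IsProbabilityMeasure (A.law θ) := by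
  unfold law; infer_instance

/-- The seed and the history of the first `t` rounds. -/
noncomputable def info (t : ℕ) (ω : A.Outcome) : A.Seed × SemiBanditHistory 𝒳 t := (ω.1, A.history ω t)

/-- The pull following the history `p`, together with its feedback when the noisy vector is `z`. -/
noncomputable def extend (t : ℕ) (p : A.Seed × SemiBanditHistory 𝒳 t) (z : Fin d → ℝ) :
    A.Seed × SemiBanditHistory 𝒳 (t + 1) :=
  (p.1, Fin.snoc (α := fun _ => 𝒳 × (Fin d → ℝ)) p.2
    (A.pull t p, semiFeedback (A.pull t p : Fin d → ℝ) z))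

theorem info_succ (t : ℕ) (ω : A.Outcome) :
    A.info (t + 1) ω = A.extend t (A.info t ω) (ω.2 t) := rfl

theorem measurable_extend (t : ℕ) :
    Measurable fun q : (A.Seed × SemiBanditHistory 𝒳 t) × (Fin d → ℝ) => A.extend t q.1 q.2 := by
  have hp : Measurable fun q : (A.Seed × SemiBanditHistory 𝒳 t) × (Fin d → ℝ) => A.pull t q.1 :=
    (A.measurable_pull t).comp measurable_fst
  refine (measurable_fst.comp measurable_fst).prodMk
    ((measurable_fin_snoc t).comp ((measurable_snd.comp measurable_fst).prodMk
      (hp.prodMk (measurable_semiFeedback.comp ((measurable_subtype_coe.comp hp).prodMk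
        measurable_snd)))))

theorem measurable_info (t : ℕ) : Measurable (A.info t) := by
  induction t with
  | zero => exact measurable_fst.prodMk (measurable_pi_iff.2 fun i => i.elim0)
  | succ t ih =>
    exact (A.measurable_extend t).comp
      (ih.prodMk ((measurable_pi_apply t).comp measurable_snd))

theorem history_congr (s : A.Seed) {ζ ζ' : ℕ → Fin d → ℝ} (n : ℕ) (h : ∀ t < n, ζ t = ζ' t) :
    A.history (s, ζ) n = A.history (s, ζ') n := by
  induction n with
  | zero => rfl
  | succ n ih =>
    have := ih fun t ht => h t (by omega)
    simp only [history, this, h n (Nat.lt_succ_self n)]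

/-- The noisy vector of a round is independent of the information available before the round. -/
theorem map_info_round (θ : Fin d → ℝ) (n : ℕ) :
    (A.law θ).map (fun ω => (A.info n ω, ω.2 n)) =
      ((A.law θ).map (A.info n)).prod (gaussianVec θ) := by
  -- Replacing the noise of round `n` by a fresh copy preserves the law and leaves `info n`
  -- unchanged, because the history of the first `n` rounds ignores that noise. The fresh copy is
  -- independent of everything else.
  have hpres : MeasurePreserving
      (fun p : A.Outcome × (Fin d → ℝ) => ((p.1.1, Function.update p.1.2 n p.2) : A.Outcome))
      ((A.law θ).prod (gaussianVec θ)) (A.law θ) := by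
    have hupd : MeasurePreserving
        (fun p : (ℕ → Fin d → ℝ) × (Fin d → ℝ) => Function.update p.1 n p.2)
        ((Measure.infinitePi fun _ : ℕ => gaussianVec θ).prod (gaussianVec θ))
        (Measure.infinitePi fun _ : ℕ => gaussianVec θ) :=
      ⟨measurable_update_prod n, Measure.map_update_infinitePi _ n⟩
    exact ((MeasurePreserving.id A.seedLaw).prod hupd).comp (measurePreserving_prodAssoc _ _ _)
  have hf : Measurable fun ω : A.Outcome => (A.info n ω, ω.2 n) :=
    (A.measurable_info n).prodMk ((measurable_pi_apply n).comp measurable_snd)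
  conv_lhs => rw [← hpres.map_eq, Measure.map_map hf hpres.measurable]
  rw [← Measure.map_id (μ := gaussianVec θ),
    Measure.map_prod_map _ _ (A.measurable_info n) measurable_id, Measure.map_id]
  congr 1
  funext p
  refine Prod.ext (Prod.ext rfl ?_) ?_
  · exact A.history_congr _ _ fun t ht => Function.update_of_ne ht.ne _ _
  · simp

theorem lintegral_info_round (θ : Fin d → ℝ) (n : ℕ)
    {f : (A.Seed × SemiBanditHistory 𝒳 n) → (Fin d → ℝ) → ℝ≥0∞}
    (hf : Measurable (Function.uncurry f)) :
    ∫⁻ ω, f (A.info n ω) (ω.2 n) ∂A.law θ =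
      ∫⁻ ω, ∫⁻ z, f (A.info n ω) z ∂gaussianVec θ ∂A.law θ := by
  have hm : Measurable fun ω : A.Outcome => (A.info n ω, ω.2 n) :=
    (A.measurable_info n).prodMk ((measurable_pi_apply n).comp measurable_snd)
  calc ∫⁻ ω, f (A.info n ω) (ω.2 n) ∂A.law θ
      = ∫⁻ q, Function.uncurry f q ∂(A.law θ).map fun ω => (A.info n ω, ω.2 n) :=
        (lintegral_map hf hm).symm
    _ = ∫⁻ p, ∫⁻ z, f p z ∂gaussianVec θ ∂(A.law θ).map (A.info n) := by
        rw [map_info_round, lintegral_prod _ hf.aemeasurable]; rfl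
    _ = _ := lintegral_map hf.lintegral_prod_right' (A.measurable_info n)

/-- The arm pulled in round `t`. -/
noncomputable def arm (t : ℕ) (ω : A.Outcome) : Fin d → ℝ := A.pull t (A.info t ω)

theorem measurable_arm (t : ℕ) : Measurable (A.arm t) :=
  measurable_subtype_coe.comp ((A.measurable_pull t).comp (A.measurable_info t))

/-- The log-likelihood ratio of the feedback of the first `n` rounds. -/
noncomputable def logRatio (θ θ' : Fin d → ℝ) (n : ℕ) (ω : A.Outcome) : ℝ :=
  ∑ t ∈ Finset.range n, semiLogRatio θ θ' (A.arm t ω) (ω.2 t)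

/-- `logRatio` as a function of the history. -/
noncomputable def historyLogRatio (θ θ' : Fin d → ℝ) {n : ℕ} (h : SemiBanditHistory 𝒳 n) : ℝ :=
  ∑ t, semiLogRatio θ θ' (h t).1 (h t).2

theorem logRatio_eq (θ θ' : Fin d → ℝ) (n : ℕ) (ω : A.Outcome) :
    A.logRatio θ θ' n ω = historyLogRatio θ θ' (A.info n ω).2 := by
  induction n with
  | zero => simp [logRatio, historyLogRatio]
  | succ n ih =>
    rw [logRatio, Finset.sum_range_succ, ← logRatio, ih, info_succ, extend, historyLogRatio,
      historyLogRatio, Fin.sum_univ_castSucc]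
    simp [semiLogRatio_semiFeedback, arm]

theorem measurable_historyLogRatio (θ θ' : Fin d → ℝ) (n : ℕ) :
    Measurable (historyLogRatio θ θ' : SemiBanditHistory 𝒳 n → ℝ) := by
  refine Finset.measurable_sum _ fun t _ => ?_
  exact (measurable_semiLogRatio θ θ').comp
    ((measurable_subtype_coe.comp (measurable_fst.comp (measurable_pi_apply t))).prodMk
      (measurable_snd.comp (measurable_pi_apply t)))

/-- Change of measure after a fixed number of rounds. -/
theorem lintegral_info_eq (θ θ' : Fin d → ℝ) (n : ℕ)
    {f : A.Seed × SemiBanditHistory 𝒳 n → ℝ≥0∞} (hf : Measurable f) :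
    ∫⁻ ω, f (A.info n ω) ∂A.law θ' =
      ∫⁻ ω, f (A.info n ω) * ENNReal.ofReal (Real.exp (A.logRatio θ θ' n ω)) ∂A.law θ := by
  induction n with
  | zero =>
    have hfst : ∀ ξ : Fin d → ℝ, ∫⁻ ω, f (A.info 0 ω) ∂A.law ξ =
        ∫⁻ s, f (s, Fin.elim0) ∂A.seedLaw := by
      intro ξ
      have hm : Measurable fun s : A.Seed => f (s, (Fin.elim0 : SemiBanditHistory 𝒳 0)) :=
        hf.comp (measurable_id.prodMk measurable_const)
      exact (measurePreserving_fst (μ := A.seedLaw)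
        (ν := Measure.infinitePi fun _ : ℕ => gaussianVec ξ)).lintegral_comp hm
    simp [logRatio, hfst]
  | succ n ih =>
    have hE := A.measurable_extend n
    have hF : Measurable fun q : (A.Seed × SemiBanditHistory 𝒳 n) × (Fin d → ℝ) =>
        f (A.extend n q.1 q.2) := hf.comp hE
    have hR : Measurable fun q : (A.Seed × SemiBanditHistory 𝒳 n) × (Fin d → ℝ) =>
        ENNReal.ofReal (Real.exp (semiLogRatio θ θ' (A.pull n q.1) q.2)) :=
      (((measurable_semiLogRatio θ θ').comp ((measurable_subtype_coe.comp
        ((A.measurable_pull n).comp measurable_fst)).prodMk measurable_snd)).exp).ennreal_ofReal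
    have hG : Measurable fun q : (A.Seed × SemiBanditHistory 𝒳 n) × (Fin d → ℝ) =>
        ENNReal.ofReal (Real.exp (historyLogRatio θ θ' q.1.2)) :=
      (((measurable_historyLogRatio θ θ' n).comp
        (measurable_snd.comp measurable_fst)).exp).ennreal_ofReal
    simp_rw [info_succ]
    -- The noise of round `n` is integrated out under `θ'`, so that the induction hypothesis applies
    -- to a function of `info n`. The one-pull change of measure then treats the inner integral with
    -- the arm frozen.
    rw [A.lintegral_info_round θ' n (f := fun p z => f (A.extend n p z)) hF,
      ih (f := fun p => ∫⁻ z, f (A.extend n p z) ∂gaussianVec θ') hF.lintegral_prod_right']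
    have hexp : ∀ ω, ENNReal.ofReal (Real.exp (A.logRatio θ θ' (n + 1) ω)) =
        ENNReal.ofReal (Real.exp (semiLogRatio θ θ' (A.pull n (A.info n ω)) (ω.2 n))) *
          ENNReal.ofReal (Real.exp (historyLogRatio θ θ' (A.info n ω).2)) := by
      intro ω
      rw [← ENNReal.ofReal_mul (Real.exp_pos _).le, ← Real.exp_add, ← logRatio_eq, logRatio,
        Finset.sum_range_succ, add_comm]
      rfl
    simp_rw [hexp]
    rw [A.lintegral_info_round θ n (f := fun p z => f (A.extend n p z) *
      (ENNReal.ofReal (Real.exp (semiLogRatio θ θ' (A.pull n p) z)) *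
        ENNReal.ofReal (Real.exp (historyLogRatio θ θ' p.2)))) (hF.mul (hR.mul hG))]
    refine lintegral_congr fun ω => ?_
    set p := A.info n ω with hp
    have hsnoc : Measurable fun y : Fin d → ℝ => f (p.1, Fin.snoc
        (α := fun _ => 𝒳 × (Fin d → ℝ)) p.2 (A.pull n p, y)) :=
      hf.comp (measurable_const.prodMk ((measurable_fin_snoc n).comp
        (measurable_const.prodMk (measurable_const.prodMk measurable_id))))
    have hgauss := lintegral_semiFeedback_gaussianVec θ θ' (A.pull n p) hsnoc
    simp_rw [← mul_assoc]
    have hm : Measurable fun z => f (A.extend n p z) *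
        ENNReal.ofReal (Real.exp (semiLogRatio θ θ' (A.pull n p) z)) :=
      (hF.mul hR).comp (measurable_const.prodMk measurable_id)
    rw [lintegral_mul_const _ hm, logRatio_eq, ← hp]
    exact congrArg (· * _) hgauss

end SemiBanditAlgorithm

/-! ### Lower bound on relative entropy by a two-valued test function. -/

/-- A two-point transportation inequality: `Λ` is the log-density of `ν` with respect to `μ` on the
σ-algebra generated by `B`. -/
theorem two_point_transportation {Ω : Type*} [MeasurableSpace Ω] {μ ν : Measure Ω}
    [IsProbabilityMeasure μ] [IsProbabilityMeasure ν] {B : Set Ω} (hB : MeasurableSet B)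
    {Λ : Ω → ℝ} (hΛ : Measurable Λ) (hint : Integrable Λ μ)
    (h1 : ν B = ∫⁻ ω in B, ENNReal.ofReal (Real.exp (Λ ω)) ∂μ)
    (h2 : ν Bᶜ = ∫⁻ ω in Bᶜ, ENNReal.ofReal (Real.exp (Λ ω)) ∂μ)
    {δ : ℝ} (hδ : 0 < δ) (hδ2 : δ < 1 / 2) (hνB : ν.real B ≤ δ) :
    (2 * μ.real B - 1) * Real.log ((1 - δ) / δ) ≤ -∫ ω, Λ ω ∂μ := by
  set r : ℝ := (1 - δ) / δ with hr
  have hr0 : 0 < r := div_pos (by linarith) hδ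
  have hr1 : 1 ≤ r := (one_le_div hδ).2 (by linarith)
  set b := Real.log r with hb
  -- The Donsker–Varadhan test function: `b` on `B` and `-b` off `B`. Integrating `1 + s ≤ exp s` at
  -- `s = φ + Λ` bounds `1 + ∫ φ dμ + ∫ Λ dμ` by `∫ exp φ dν`, which the choice of `b` keeps at most
  -- `1`.
  set φ : Ω → ℝ := fun ω => B.indicator (fun _ => 2 * b) ω - b with hφ
  have hφm : Measurable φ := (measurable_const.indicator hB).sub_const b
  have hφint : Integrable φ μ := ((integrable_const _).indicator hB).sub (integrable_const _)
  have hφB : ∀ ω ∈ B, Real.exp (φ ω + Λ ω) = r * Real.exp (Λ ω) := fun ω hω => by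
    rw [hφ, Real.exp_add]
    simp only [Set.indicator_of_mem hω]
    rw [two_mul, add_sub_cancel_right, hb, Real.exp_log hr0]
  have hφBc : ∀ ω ∈ Bᶜ, Real.exp (φ ω + Λ ω) = r⁻¹ * Real.exp (Λ ω) := fun ω hω => by
    rw [hφ, Real.exp_add]
    simp only [Set.indicator_of_notMem hω]
    rw [zero_sub, Real.exp_neg, hb, Real.exp_log hr0]
  have hlint : ∫⁻ ω, ENNReal.ofReal (Real.exp (φ ω + Λ ω)) ∂μ =
      ENNReal.ofReal (r * ν.real B + r⁻¹ * ν.real Bᶜ) := by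
    rw [← lintegral_add_compl _ hB,
      setLIntegral_congr_fun hB (g := fun ω => ENNReal.ofReal r * ENNReal.ofReal (Real.exp (Λ ω)))
        (fun ω hω => by simp only [hφB ω hω, ENNReal.ofReal_mul hr0.le]),
      setLIntegral_congr_fun hB.compl
        (g := fun ω => ENNReal.ofReal r⁻¹ * ENNReal.ofReal (Real.exp (Λ ω)))
        (fun ω hω => by simp only [hφBc ω hω, ENNReal.ofReal_mul (inv_nonneg.2 hr0.le)]),
      lintegral_const_mul _ (by fun_prop), lintegral_const_mul _ (by fun_prop), ← h1, ← h2,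
      ENNReal.ofReal_add (by positivity) (by positivity), ENNReal.ofReal_mul hr0.le,
      ENNReal.ofReal_mul (inv_nonneg.2 hr0.le), ofReal_measureReal, ofReal_measureReal]
  have hFint : Integrable (fun ω => Real.exp (φ ω + Λ ω)) μ := by
    refine ⟨((hφm.add hΛ).exp).aestronglyMeasurable, ?_⟩
    rw [hasFiniteIntegral_iff_ofReal (Filter.Eventually.of_forall fun _ => (Real.exp_pos _).le),
      hlint]
    exact ENNReal.ofReal_lt_top
  have hFval : ∫ ω, Real.exp (φ ω + Λ ω) ∂μ = r * ν.real B + r⁻¹ * ν.real Bᶜ := by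
    rw [integral_eq_lintegral_of_nonneg_ae
      (Filter.Eventually.of_forall fun _ => (Real.exp_pos _).le) hFint.aestronglyMeasurable, hlint,
      ENNReal.toReal_ofReal (by positivity)]
  have hle1 : r * ν.real B + r⁻¹ * ν.real Bᶜ ≤ 1 := by
    rw [probReal_compl_eq_one_sub hB]
    -- The expression is nondecreasing in `ν.real B`, and at `δ` it equals `(1 - δ) + δ = 1`.
    have hinv : r⁻¹ ≤ r := (inv_le_one_of_one_le₀ hr1).trans hr1
    have hval : r * δ + r⁻¹ * (1 - δ) = 1 := by
      have : (1 - δ) ≠ 0 := by linarith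
      rw [hr]
      field_simp
      ring
    nlinarith [mul_le_mul_of_nonneg_left hνB (sub_nonneg.2 hinv)]
  have hmono : ∫ ω, (1 + (φ ω + Λ ω)) ∂μ ≤ ∫ ω, Real.exp (φ ω + Λ ω) ∂μ :=
    integral_mono ((integrable_const _).add (hφint.add hint)) hFint fun ω => by
      have := Real.add_one_le_exp (φ ω + Λ ω)
      simp only
      linarith
  have hφval : ∫ ω, φ ω ∂μ = (2 * μ.real B - 1) * b := by
    rw [hφ, integral_sub ((integrable_const _).indicator hB) (integrable_const _),
      integral_indicator_const _ hB]
    simp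
    ring
  have hsum : ∫ ω, (1 + (φ ω + Λ ω)) ∂μ = 1 + ((2 * μ.real B - 1) * b + ∫ ω, Λ ω ∂μ) := by
    rw [integral_add (integrable_const _) (show Integrable (fun ω => φ ω + Λ ω) μ from
      hφint.add hint), integral_add hφint hint, hφval]
    simp
  rw [hsum, hFval] at hmono
  linarith

/-! ### The filtration, the stopping time and the stopped likelihood ratio. -/

namespace SemiBanditAlgorithm

variable {d : ℕ} {𝒳 : Finset (Fin d → ℝ)} (A : SemiBanditAlgorithm.{u} 𝒳)

/-- The σ-algebra of the information available after `n` rounds. -/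
@[reducible]
noncomputable def infoSpace (n : ℕ) : MeasurableSpace A.Outcome :=
  MeasurableSpace.comap (A.info n) inferInstance

theorem infoSpace_le (n : ℕ) : A.infoSpace n ≤ (inferInstance : MeasurableSpace A.Outcome) :=
  (A.measurable_info n).comap_le

theorem infoSpace_mono : Monotone A.infoSpace := by
  refine monotone_nat_of_le_succ fun n => ?_
  have h : A.info n = (fun q : A.Seed × SemiBanditHistory 𝒳 (n + 1) =>
      ((q.1, fun i => q.2 i.castSucc) : A.Seed × SemiBanditHistory 𝒳 n)) ∘ A.info (n + 1) := by
    funext ω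
    refine Prod.ext rfl ?_
    funext i
    simp [info_succ, extend]
  rw [infoSpace, h, ← MeasurableSpace.comap_comp]
  refine MeasurableSpace.comap_mono (Measurable.comap_le ?_)
  exact measurable_fst.prodMk (measurable_pi_iff.2 fun i =>
    (measurable_pi_apply _).comp measurable_snd)

theorem law_apply_of_infoSpace (θ θ' : Fin d → ℝ) (n : ℕ) {D : Set A.Outcome}
    (hD : MeasurableSet[A.infoSpace n] D) :
    A.law θ' D = ∫⁻ ω in D, ENNReal.ofReal (Real.exp (A.logRatio θ θ' n ω)) ∂A.law θ := by
  classical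
  have hDm := A.infoSpace_le n D hD
  obtain ⟨S, hS, rfl⟩ := hD
  have h := A.lintegral_info_eq θ θ' n (f := S.indicator fun _ => 1)
    (measurable_const.indicator hS)
  rw [← lintegral_indicator_one hDm, ← lintegral_indicator hDm]
  refine Eq.trans h (lintegral_congr fun ω => ?_)
  by_cases hω : A.info n ω ∈ S
  · rw [Set.indicator_of_mem (show ω ∈ A.info n ⁻¹' S from hω), Set.indicator_of_mem hω]
    simp
  · rw [Set.indicator_of_notMem (show ω ∉ A.info n ⁻¹' S from hω), Set.indicator_of_notMem hω]
    simp

/-- The event is decided before the noise of round `n` is drawn, so expectations factor. This is the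
one-round form of Wald's identity. -/
theorem indicator_round (θ : Fin d → ℝ) (n : ℕ) {D : Set A.Outcome}
    (hD : MeasurableSet[A.infoSpace n] D) {g : (Fin d → ℝ) → ℝ}
    (hg : Integrable g (gaussianVec θ)) :
    Integrable (D.indicator fun ω => g (ω.2 n)) (A.law θ) ∧
      ∫ ω, D.indicator (fun ω => g (ω.2 n)) ω ∂A.law θ =
        (A.law θ).real D * ∫ z, g z ∂gaussianVec θ := by
  obtain ⟨S, hS, rfl⟩ := hD
  have hm : Measurable fun ω : A.Outcome => (A.info n ω, ω.2 n) :=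
    (A.measurable_info n).prodMk ((measurable_pi_apply n).comp measurable_snd)
  have hprob : IsProbabilityMeasure ((A.law θ).map (A.info n)) :=
    Measure.isProbabilityMeasure_map (A.measurable_info n).aemeasurable
  have hind : Integrable (S.indicator fun _ => (1 : ℝ)) ((A.law θ).map (A.info n)) :=
    (integrable_const _).indicator hS
  have hI := hind.mul_prod hg
  have heq : ((A.info n ⁻¹' S).indicator fun ω => g (ω.2 n)) =
      (fun q : (A.Seed × SemiBanditHistory 𝒳 n) × (Fin d → ℝ) =>
        S.indicator (fun _ => (1 : ℝ)) q.1 * g q.2) ∘ fun ω => (A.info n ω, ω.2 n) := by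
    funext ω
    by_cases hω : A.info n ω ∈ S
    · rw [Set.indicator_of_mem (show ω ∈ A.info n ⁻¹' S from hω)]
      simp [Set.indicator_of_mem hω]
    · rw [Set.indicator_of_notMem (show ω ∉ A.info n ⁻¹' S from hω)]
      simp [Set.indicator_of_notMem hω]
  rw [← A.map_info_round θ n] at hI
  refine ⟨?_, ?_⟩
  · rw [heq]
    exact hI.comp_measurable hm
  · rw [heq]
    have := integral_map hm.aemeasurable hI.aestronglyMeasurable
    simp only [Function.comp_apply]
    rw [← this, A.map_info_round θ n,
      integral_prod_mul (S.indicator fun _ => (1 : ℝ)) g, integral_indicator_const _ hS,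
      map_measureReal_apply (A.measurable_info n) hS]
    simp

theorem le_numPulls_iff (n : ℕ) (ω : A.Outcome) :
    (n : ℕ∞) ≤ A.numPulls ω ↔ ∀ k < n, A.info k ω ∉ A.stopSet k := by
  unfold numPulls
  rw [le_iInf₂_iff]
  constructor
  · intro h k hk hmem
    have := h k hmem
    rw [Nat.cast_le] at this
    omega
  · intro h k hk
    rw [Nat.cast_le]
    by_contra hlt
    exact h k (by omega) hk

/-- The index gap matters: whether one more pull follows the first `n` is already decided by their
history. -/
theorem measurableSet_succ_le_numPulls (n : ℕ) :
    MeasurableSet[A.infoSpace n] {ω | ((n + 1 : ℕ) : ℕ∞) ≤ A.numPulls ω} := by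
  have : {ω | ((n + 1 : ℕ) : ℕ∞) ≤ A.numPulls ω} =
      ⋂ k ∈ Finset.range (n + 1), (A.info k ⁻¹' A.stopSet k)ᶜ := by
    ext ω
    simp only [Set.mem_ofPred_eq, le_numPulls_iff, Set.mem_iInter, Finset.mem_range,
      Set.mem_compl_iff, Set.mem_preimage]
  rw [this]
  refine Finset.measurableSet_biInter _ fun k hk => MeasurableSet.compl ?_
  exact A.infoSpace_mono (Nat.lt_succ_iff.1 (Finset.mem_range.1 hk)) _
    ⟨_, A.measurableSet_stopSet k, rfl⟩

theorem measurableSet_le_numPulls (n : ℕ) :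
    MeasurableSet[A.infoSpace n] {ω | (n : ℕ∞) ≤ A.numPulls ω} := by
  cases n with
  | zero => simp
  | succ n => exact A.infoSpace_mono n.le_succ _ (A.measurableSet_succ_le_numPulls n)

theorem measurableSet_numPulls_eq (n : ℕ) :
    MeasurableSet[A.infoSpace n] {ω | A.numPulls ω = n} := by
  have : {ω | A.numPulls ω = n} =
      {ω | (n : ℕ∞) ≤ A.numPulls ω} \ {ω | ((n + 1 : ℕ) : ℕ∞) ≤ A.numPulls ω} := by
    ext ω
    simp only [Set.mem_ofPred_eq, Set.mem_sdiff]
    rw [Nat.cast_succ, ENat.add_one_le_iff (ENat.natCast_ne_top n), not_lt, le_antisymm_iff, and_comm]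
  rw [this]
  exact (A.measurableSet_le_numPulls n).diff (A.measurableSet_succ_le_numPulls n)

/-- The algorithm has not stopped after `t` rounds. -/
noncomputable def running (t : ℕ) : Set A.Outcome := {ω | (t : ℕ∞) < A.numPulls ω}

theorem mem_running {t : ℕ} {ω : A.Outcome} : ω ∈ A.running t ↔ (t : ℕ∞) < A.numPulls ω := Iff.rfl

theorem measurableSet_running (t : ℕ) : MeasurableSet[A.infoSpace t] (A.running t) := by
  have : A.running t = {ω | ((t + 1 : ℕ) : ℕ∞) ≤ A.numPulls ω} := by
    ext ω
    simp only [running, Set.mem_ofPred_eq]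
    rw [Nat.cast_succ, ENat.add_one_le_iff (ENat.natCast_ne_top t)]
  rw [this]
  exact A.measurableSet_succ_le_numPulls t

/-- The log-likelihood ratio of the feedback received in the first `n` rounds and before the
algorithm stops. -/
noncomputable def stoppedLogRatio (θ θ' : Fin d → ℝ) (n : ℕ) (ω : A.Outcome) : ℝ :=
  ∑ t ∈ Finset.range n,
    (A.running t).indicator (fun ω => semiLogRatio θ θ' (A.arm t ω) (ω.2 t)) ω

theorem measurable_stoppedLogRatio (θ θ' : Fin d → ℝ) (n : ℕ) :
    Measurable (A.stoppedLogRatio θ θ' n) := by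
  unfold stoppedLogRatio
  refine Finset.measurable_sum _ fun t _ => Measurable.indicator ?_
    (A.infoSpace_le t _ (A.measurableSet_running t))
  exact (measurable_semiLogRatio θ θ').comp
    ((A.measurable_arm t).prodMk ((measurable_pi_apply t).comp measurable_snd))

theorem stoppedLogRatio_eq_of_le (θ θ' : Fin d → ℝ) {n : ℕ} {ω : A.Outcome}
    (h : (n : ℕ∞) ≤ A.numPulls ω) : A.stoppedLogRatio θ θ' n ω = A.logRatio θ θ' n ω := by
  refine Finset.sum_congr rfl fun t ht => Set.indicator_of_mem ?_ _
  exact lt_of_lt_of_le (Nat.cast_lt.2 (Finset.mem_range.1 ht)) h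

theorem stoppedLogRatio_succ_of_le (θ θ' : Fin d → ℝ) {n : ℕ} {ω : A.Outcome}
    (h : A.numPulls ω ≤ n) : A.stoppedLogRatio θ θ' (n + 1) ω = A.stoppedLogRatio θ θ' n ω := by
  rw [stoppedLogRatio, Finset.sum_range_succ, Set.indicator_of_notMem (by simpa [running] using h),
    add_zero]
  rfl

/-- Change of measure on an event that is known when the algorithm stops, if it stops before
round `n`. -/
theorem law_inter_lt (θ θ' : Fin d → ℝ) {D : Set A.Outcome}
    (hD : ∀ k : ℕ, MeasurableSet[A.infoSpace k] (D ∩ {ω | A.numPulls ω = k})) (n : ℕ) :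
    A.law θ' (D ∩ {ω | A.numPulls ω < n}) =
      ∫⁻ ω in D ∩ {ω | A.numPulls ω < n},
        ENNReal.ofReal (Real.exp (A.stoppedLogRatio θ θ' n ω)) ∂A.law θ := by
  induction n with
  | zero => simp
  | succ n ih =>
    have hsplit : D ∩ {ω | A.numPulls ω < (n + 1 : ℕ)} =
        (D ∩ {ω | A.numPulls ω < n}) ∪ (D ∩ {ω | A.numPulls ω = n}) := by
      rw [← Set.inter_union_distrib_left]
      congr 1
      ext ω
      simp only [Set.mem_ofPred_eq, Set.mem_union]
      rw [Nat.cast_succ, ENat.lt_add_one_iff (ENat.natCast_ne_top n), le_iff_lt_or_eq]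
    have hdisj : Disjoint (D ∩ {ω | A.numPulls ω < n}) (D ∩ {ω | A.numPulls ω = n}) := by
      refine Set.disjoint_left.2 fun ω h1 h2 => ?_
      exact (ne_of_lt h1.2) h2.2
    have hm2 : MeasurableSet (D ∩ {ω | A.numPulls ω = n}) := A.infoSpace_le n _ (hD n)
    have hm1 : MeasurableSet (D ∩ {ω | A.numPulls ω < n}) := by
      have : D ∩ {ω | A.numPulls ω < n} =
          ⋃ k ∈ Finset.range n, D ∩ {ω | A.numPulls ω = k} := by
        ext ω
        simp only [Set.mem_inter_iff, Set.mem_ofPred_eq, Set.mem_iUnion, Finset.mem_range,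
          exists_prop]
        constructor
        · rintro ⟨h1, h2⟩
          obtain ⟨k, hk⟩ := ENat.ne_top_iff_exists.1 (ne_top_of_lt h2)
          rw [← hk, Nat.cast_lt] at h2
          exact ⟨k, h2, h1, hk.symm⟩
        · rintro ⟨k, hk, h1, h2⟩
          exact ⟨h1, h2 ▸ Nat.cast_lt.2 hk⟩
      rw [this]
      exact Finset.measurableSet_biUnion _ fun k _ => A.infoSpace_le k _ (hD k)
    rw [hsplit, measure_union hdisj hm2, lintegral_union hm2 hdisj, ih,
      A.law_apply_of_infoSpace θ θ' n (hD n)]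
    -- Neither piece has a pull at index `n`, so the additional summand vanishes. On `T = n` the
    -- stopped ratio is the full ratio after `n` rounds.
    congr 1
    · refine setLIntegral_congr_fun hm1 fun ω hω => ?_
      simp only [A.stoppedLogRatio_succ_of_le θ θ' (le_of_lt hω.2)]
    · refine setLIntegral_congr_fun hm2 fun ω hω => ?_
      simp only [A.stoppedLogRatio_succ_of_le θ θ' (le_of_eq hω.2),
        A.stoppedLogRatio_eq_of_le θ θ' (ge_of_eq hω.2)]

theorem law_le_numPulls (θ θ' : Fin d → ℝ) (n : ℕ) :
    A.law θ' {ω | (n : ℕ∞) ≤ A.numPulls ω} =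
      ∫⁻ ω in {ω | (n : ℕ∞) ≤ A.numPulls ω},
        ENNReal.ofReal (Real.exp (A.stoppedLogRatio θ θ' n ω)) ∂A.law θ := by
  rw [A.law_apply_of_infoSpace θ θ' n (A.measurableSet_le_numPulls n)]
  refine setLIntegral_congr_fun (A.infoSpace_le n _ (A.measurableSet_le_numPulls n)) fun ω hω => ?_
  simp only [A.stoppedLogRatio_eq_of_le θ θ' hω]

/-- The event that round `t` takes place and `x` is pulled in it. -/
noncomputable def pullEvent (x : 𝒳) (t : ℕ) : Set A.Outcome :=
  A.running t ∩ {ω | A.pull t (A.info t ω) = x}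

theorem measurableSet_pullEvent (x : 𝒳) (t : ℕ) :
    MeasurableSet[A.infoSpace t] (A.pullEvent x t) := by
  refine MeasurableSet.inter (A.measurableSet_running t) ?_
  exact ⟨A.pull t ⁻¹' {x}, A.measurable_pull t (measurableSet_singleton x), rfl⟩

theorem indicator_running_eq_sum (t : ℕ) (f : A.Outcome → ℝ) (ω : A.Outcome) :
    (A.running t).indicator f ω = ∑ x : 𝒳, (A.pullEvent x t).indicator f ω := by
  classical
  by_cases h : ω ∈ A.running t
  · rw [Set.indicator_of_mem h, Finset.sum_eq_single (A.pull t (A.info t ω))]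
    · rw [Set.indicator_of_mem (show ω ∈ A.pullEvent _ t from ⟨h, rfl⟩)]
    · intro x _ hx
      exact Set.indicator_of_notMem (fun h' => hx h'.2.symm) _
    · simp
  · rw [Set.indicator_of_notMem h]
    exact (Finset.sum_eq_zero fun x _ => Set.indicator_of_notMem (fun h' => h h'.1) _).symm

/-- Splitting by the arm pulled makes the summand depend on the noise of its round alone, as
`indicator_round` requires. -/
theorem stoppedLogRatio_eq_sum (θ θ' : Fin d → ℝ) (n : ℕ) :
    A.stoppedLogRatio θ θ' n = fun ω => ∑ t ∈ Finset.range n, ∑ x : 𝒳,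
      (A.pullEvent x t).indicator (fun ω => semiLogRatio θ θ' x (ω.2 t)) ω := by
  funext ω
  refine Finset.sum_congr rfl fun t _ => ?_
  rw [indicator_running_eq_sum]
  refine Finset.sum_congr rfl fun x _ => ?_
  by_cases h : ω ∈ A.pullEvent x t
  · rw [Set.indicator_of_mem h, Set.indicator_of_mem h, arm, h.2]
  · rw [Set.indicator_of_notMem h, Set.indicator_of_notMem h]

theorem integrable_stoppedLogRatio (θ θ' : Fin d → ℝ) (n : ℕ) :
    Integrable (A.stoppedLogRatio θ θ' n) (A.law θ) := by
  rw [stoppedLogRatio_eq_sum]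
  exact integrable_finsetSum _ fun t _ => integrable_finsetSum _ fun x _ =>
    (A.indicator_round θ t (A.measurableSet_pullEvent x t) (integrable_semiLogRatio θ θ' x)).1

theorem integral_stoppedLogRatio (θ θ' : Fin d → ℝ) (n : ℕ) :
    -∫ ω, A.stoppedLogRatio θ θ' n ω ∂A.law θ = ∑ t ∈ Finset.range n, ∑ x : 𝒳,
      (A.law θ).real (A.pullEvent x t) * semiDivergence θ θ' x := by
  have h := fun (t : ℕ) (x : 𝒳) =>
    A.indicator_round θ t (A.measurableSet_pullEvent x t) (integrable_semiLogRatio θ θ' x)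
  rw [stoppedLogRatio_eq_sum,
    integral_finsetSum _ fun t _ => integrable_finsetSum _ fun x _ => (h t x).1,
    ← Finset.sum_neg_distrib]
  refine Finset.sum_congr rfl fun t _ => ?_
  rw [integral_finsetSum _ fun x _ => (h t x).1, ← Finset.sum_neg_distrib]
  refine Finset.sum_congr rfl fun x _ => ?_
  rw [(h t x).2, integral_semiLogRatio]
  ring

theorem measurableSet_returns_inter (x : Fin d → ℝ) (k : ℕ) :
    MeasurableSet[A.infoSpace k] (A.returns x ∩ {ω | A.numPulls ω = k}) := by
  have : A.returns x ∩ {ω | A.numPulls ω = k} =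
      {ω | A.numPulls ω = k} ∩ A.info k ⁻¹' {p | (A.answer k p : Fin d → ℝ) = x} := by
    ext ω
    simp only [returns, Set.mem_inter_iff, Set.mem_ofPred_eq, Set.mem_preimage]
    constructor
    · rintro ⟨⟨t, ht, hx⟩, hk⟩
      have : t = k := by exact_mod_cast ht.symm.trans hk
      subst this
      exact ⟨hk, hx⟩
    · rintro ⟨hk, hx⟩
      exact ⟨⟨k, hk, hx⟩, hk⟩
  rw [this]
  exact (A.measurableSet_numPulls_eq k).inter
    ⟨_, (measurable_subtype_coe.comp (A.measurable_answer k)) (measurableSet_singleton x), rfl⟩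

theorem returns_eq_iUnion (x : Fin d → ℝ) :
    A.returns x = ⋃ k : ℕ, A.returns x ∩ {ω | A.numPulls ω = k} := by
  ext ω
  simp only [Set.mem_iUnion, Set.mem_inter_iff, Set.mem_ofPred_eq]
  exact ⟨fun h => ⟨h.choose, h, h.choose_spec.1⟩, fun ⟨_, h, _⟩ => h⟩

theorem measurableSet_returns (x : Fin d → ℝ) : MeasurableSet (A.returns x) := by
  rw [returns_eq_iUnion]
  exact MeasurableSet.iUnion fun k => A.infoSpace_le k _ (A.measurableSet_returns_inter x k)

theorem measurableSet_numPulls_lt (n : ℕ) : MeasurableSet {ω | A.numPulls ω < n} := by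
  have h := A.infoSpace_le n _ (A.measurableSet_le_numPulls n)
  convert h.compl using 1
  ext ω
  simp

/-! ### Transportation inequality, with the horizon sent to infinity. -/

/-- The transportation inequality for a finite horizon. -/
theorem transportation_finite (θ θ' x : Fin d → ℝ) (n : ℕ) {δ : ℝ} (hδ : 0 < δ) (hδ2 : δ < 1 / 2)
    (h' : (A.law θ').real (A.returns x) ≤ δ) :
    (2 * (A.law θ).real (A.returns x ∩ {ω | A.numPulls ω < n}) - 1) * Real.log ((1 - δ) / δ) ≤
      ∑ t ∈ Finset.range n, ∑ y : 𝒳,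
        (A.law θ).real (A.pullEvent y t) * semiDivergence θ θ' y := by
  rw [← integral_stoppedLogRatio]
  have hret := A.measurableSet_returns_inter x
  have hle := A.infoSpace_le n _ (A.measurableSet_le_numPulls n)
  have hcompl : ∀ k : ℕ,
      MeasurableSet[A.infoSpace k] ((A.returns x)ᶜ ∩ {ω | A.numPulls ω = k}) := fun k => by
    convert (A.measurableSet_numPulls_eq k).diff (hret k) using 1
    ext ω
    simp only [Set.mem_inter_iff, Set.mem_sdiff, Set.mem_compl_iff, Set.mem_ofPred_eq]
    tauto
  have hB := (A.measurableSet_returns x).inter (A.measurableSet_numPulls_lt n)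
  refine two_point_transportation hB (A.measurable_stoppedLogRatio θ θ' n)
    (A.integrable_stoppedLogRatio θ θ' n) (A.law_inter_lt θ θ' hret n) ?_ hδ hδ2
    ((measureReal_mono Set.inter_subset_left).trans h')
  -- Runs still going at the horizon count as not returning `x`. Both pieces are known by time `min
  -- T n`, so no finiteness of `T` under `θ'` is needed.
  have hsplit : (A.returns x ∩ {ω | A.numPulls ω < n})ᶜ =
      ((A.returns x)ᶜ ∩ {ω | A.numPulls ω < n}) ∪ {ω | (n : ℕ∞) ≤ A.numPulls ω} := by
    ext ω
    simp only [Set.mem_compl_iff, Set.mem_inter_iff, Set.mem_union, Set.mem_ofPred_eq, ← not_lt]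
    tauto
  have hdisj : Disjoint ((A.returns x)ᶜ ∩ {ω | A.numPulls ω < n})
      {ω | (n : ℕ∞) ≤ A.numPulls ω} :=
    Set.disjoint_left.2 fun ω h1 h2 =>
      not_lt_of_ge (show (n : ℕ∞) ≤ A.numPulls ω from h2) h1.2
  rw [hsplit, measure_union hdisj hle, lintegral_union hle hdisj, A.law_inter_lt θ θ' hcompl n,
    A.law_le_numPulls θ θ' n]

theorem tendsto_returns_inter (θ x : Fin d → ℝ) :
    Filter.Tendsto (fun n : ℕ => (A.law θ).real (A.returns x ∩ {ω | A.numPulls ω < n}))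
      Filter.atTop (nhds ((A.law θ).real (A.returns x))) := by
  have hU : A.returns x = ⋃ n : ℕ, A.returns x ∩ {ω | A.numPulls ω < n} := by
    ext ω
    simp only [Set.mem_iUnion, Set.mem_inter_iff, Set.mem_ofPred_eq]
    refine ⟨fun h => ?_, fun ⟨_, h, _⟩ => h⟩
    obtain ⟨k, hk, -⟩ := id h
    exact ⟨k + 1, h, hk ▸ Nat.cast_lt.2 k.lt_succ_self⟩
  have hmono : Monotone fun n : ℕ => A.returns x ∩ {ω | A.numPulls ω < n} := fun m n hmn ω h =>
    ⟨h.1, lt_of_lt_of_le (show A.numPulls ω < m from h.2) (Nat.cast_le.2 hmn)⟩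
  have h := tendsto_measure_iUnion_atTop (μ := A.law θ) hmono
  rw [← hU] at h
  exact (ENNReal.tendsto_toReal (measure_ne_top _ _)).comp h

/-- The expected number of pulls of `x`. -/
noncomputable def expectedPulls (θ : Fin d → ℝ) (x : 𝒳) : ℝ≥0∞ :=
  ∑' t, A.law θ (A.pullEvent x t)

/-- `T` is the sum over `t` of the indicators of `t < T`, also when `T = ∞`, and every round that
takes place pulls exactly one arm. -/
theorem lintegral_numPulls (θ : Fin d → ℝ) :
    ∫⁻ ω, (A.numPulls ω : ℝ≥0∞) ∂A.law θ = ∑ x : 𝒳, A.expectedPulls θ x := by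
  classical
  have hT : ∀ ω, (A.numPulls ω : ℝ≥0∞) = ∑' t, (A.running t).indicator 1 ω := by
    intro ω
    rcases eq_or_ne (A.numPulls ω) ⊤ with h | h
    · have : ∀ t, (A.running t).indicator (1 : A.Outcome → ℝ≥0∞) ω = 1 := fun t =>
        Set.indicator_of_mem (A.mem_running.2 (h ▸ ENat.natCast_lt_top t)) _
      simp [h, this]
    · obtain ⟨k, hk⟩ := ENat.ne_top_iff_exists.1 h
      rw [tsum_eq_sum (s := Finset.range k)]
      · have : ∀ t ∈ Finset.range k, (A.running t).indicator (1 : A.Outcome → ℝ≥0∞) ω = 1 :=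
          fun t ht => Set.indicator_of_mem
            (A.mem_running.2 (hk ▸ Nat.cast_lt.2 (Finset.mem_range.1 ht))) _
        rw [Finset.sum_congr rfl this]
        simp [← hk]
      · intro t ht
        refine Set.indicator_of_notMem (fun h' => ht ?_) _
        rw [mem_running, ← hk, Nat.cast_lt] at h'
        exact Finset.mem_range.2 h'
  have hrun : ∀ t, MeasurableSet (A.running t) := fun t =>
    A.infoSpace_le t _ (A.measurableSet_running t)
  simp_rw [hT]
  rw [lintegral_tsum fun t => (measurable_one.indicator (hrun t)).aemeasurable]
  simp_rw [lintegral_indicator_one (hrun _), expectedPulls]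
  rw [← Summable.tsum_finsetSum fun x _ => ENNReal.summable]
  congr 1
  funext t
  rw [← measure_biUnion_finset]
  · congr 1
    ext ω
    simp [pullEvent]
  · intro x _ y _ hxy
    exact Set.disjoint_left.2 fun ω h1 h2 => hxy (h1.2.symm.trans h2.2)
  · exact fun x _ => A.infoSpace_le t _ (A.measurableSet_pullEvent x t)

/-- The transportation inequality. -/
theorem transportation (θ θ' x : Fin d → ℝ) {δ : ℝ} (hδ : 0 < δ) (hδ2 : δ < 1 / 2)
    (hfin : ∫⁻ ω, (A.numPulls ω : ℝ≥0∞) ∂A.law θ ≠ ∞)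
    (h : 1 - δ ≤ (A.law θ).real (A.returns x)) (h' : (A.law θ').real (A.returns x) ≤ δ) :
    (1 - 2 * δ) * Real.log ((1 - δ) / δ) ≤
      ∑ y : 𝒳, (A.expectedPulls θ y).toReal * semiDivergence θ θ' y := by
  rw [lintegral_numPulls] at hfin
  have hfin' : ∀ y, A.expectedPulls θ y ≠ ∞ := fun y =>
    ENNReal.sum_ne_top.1 hfin y (Finset.mem_univ y)
  have hlog : 0 ≤ Real.log ((1 - δ) / δ) :=
    Real.log_nonneg ((one_le_div hδ).2 (by linarith))
  have hlim : (2 * (A.law θ).real (A.returns x) - 1) * Real.log ((1 - δ) / δ) ≤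
      ∑ y : 𝒳, (A.expectedPulls θ y).toReal * semiDivergence θ θ' y := by
    -- Only the left side needs a limit: the truncated pull counts on the right are bounded by the
    -- full expectations, since the divergences are nonnegative.
    refine le_of_tendsto' ((((A.tendsto_returns_inter θ x).const_mul 2).sub_const 1).mul_const _)
      fun n => (A.transportation_finite θ θ' x n hδ hδ2 h').trans ?_
    rw [Finset.sum_comm]
    refine Finset.sum_le_sum fun y _ => ?_
    rw [← Finset.sum_mul]
    refine mul_le_mul_of_nonneg_right ?_ (semiDivergence_nonneg _ _ _)
    simp only [measureReal_def]
    rw [← ENNReal.toReal_sum fun t _ => measure_ne_top _ _]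
    exact ENNReal.toReal_mono (hfin' y) (ENNReal.sum_le_tsum _)
  refine le_trans (mul_le_mul_of_nonneg_right ?_ hlog) hlim
  linarith

end SemiBanditAlgorithm

/-! ### Numerical constant, cheapest alternative and perturbation to a unique best arm. -/

theorem log_le_two_mul_binary_divergence {δ : ℝ} (hδ : 0 < δ) (hδ' : 2.4 * δ < 1) :
    Real.log (1 / (2.4 * δ)) ≤ 2 * ((1 - 2 * δ) * Real.log ((1 - δ) / δ)) := by
  set u := 1 / (2.4 * δ) with hu
  set r := (1 - δ) / δ with hr
  have hu0 : 0 < u := by positivity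
  have hr0 : 0 < r := div_pos (by linarith) hδ
  have hlogr : 0 ≤ Real.log r := Real.log_nonneg ((one_le_div hδ).2 (by linarith))
  -- On the ranges up to `1/4`, up to `1/3` and up to `1/2.4`, the factor `2(1 - 2δ)` is at least
  -- `1`, `2/3` and `1/3`. It remains to compare `u ≤ r`, `u³ ≤ r²` and `u³ ≤ r`, which are
  -- polynomial inequalities in `δ`.
  rcases le_total δ (1 / 4) with h1 | h1
  · have : Real.log u ≤ Real.log r := by
      refine Real.log_le_log hu0 ?_
      rw [hu, hr, div_le_div_iff₀ (by positivity) hδ]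
      nlinarith
    nlinarith
  rcases le_total δ (1 / 3) with h2 | h2
  · have : Real.log (u ^ 3) ≤ Real.log (r ^ 2) := by
      refine Real.log_le_log (by positivity) ?_
      rw [hu, hr, div_pow, div_pow, div_le_div_iff₀ (by positivity) (by positivity)]
      have : 1 ≤ 2.4 ^ 3 * δ * (1 - δ) ^ 2 := by
        nlinarith [mul_nonneg (sub_nonneg.2 h1) (sub_nonneg.2 h2)]
      nlinarith [mul_le_mul_of_nonneg_left this (sq_nonneg δ)]
    rw [Real.log_pow, Real.log_pow] at this
    push_cast at this
    nlinarith
  · have : Real.log (u ^ 3) ≤ Real.log r := by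
      refine Real.log_le_log (by positivity) ?_
      rw [hu, hr, div_pow, div_le_div_iff₀ (by positivity) hδ]
      have : 1 ≤ 2.4 ^ 3 * δ ^ 2 * (1 - δ) := by
        nlinarith [mul_nonneg (sub_nonneg.2 h2) (sub_nonneg.2 hδ'.le)]
      nlinarith [mul_le_mul_of_nonneg_left this hδ.le]
    rw [Real.log_pow] at this
    push_cast at this
    nlinarith

/-- The cheapest way to move `θ` to the half-space `θ' ⬝ᵥ v ≤ 0` for a diagonal quadratic cost. -/
theorem diagonal_cost_lower_bound {d : ℕ} {a θ v : Fin d → ℝ} {K : ℝ} (ha : ∀ j, 0 ≤ a j)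
    (hK : 0 < K) (hΔ : 0 < θ ⬝ᵥ v)
    (h : ∀ θ' : Fin d → ℝ, θ' ⬝ᵥ v ≤ 0 → K ≤ ∑ j, a j * ((θ' j - θ j) ^ 2 / 2)) :
    (∀ j, v j ≠ 0 → 0 < a j) ∧ 2 * K * ∑ j, v j ^ 2 / a j ≤ (θ ⬝ᵥ v) ^ 2 := by
  classical
  set Δ := θ ⬝ᵥ v with hΔdef
  have hpos : ∀ j, v j ≠ 0 → 0 < a j := by
    intro j hj
    refine (ha j).lt_of_ne fun h0 => ?_
    -- If `a j = 0`, moving coordinate `j` alone reaches the boundary of the half-space at no cost,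
    -- contradicting `K > 0`.
    have := h (θ - Pi.single j (Δ / v j)) (by
      rw [sub_dotProduct, single_dotProduct, div_mul_cancel₀ _ hj, sub_self])
    rw [Finset.sum_eq_zero] at this
    · linarith
    · intro i _
      by_cases hi : i = j
      · subst hi
        simp [← h0]
      · simp [Pi.single_eq_of_ne hi]
  refine ⟨hpos, ?_⟩
  set S := ∑ j, v j ^ 2 / a j with hS
  have hterm : ∀ j, 0 ≤ v j ^ 2 / a j := fun j => div_nonneg (sq_nonneg _) (ha j)
  have hS0 : 0 < S := by
    obtain ⟨j, hj⟩ : ∃ j, v j ≠ 0 := by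
      by_contra! hv
      exact hΔ.ne' (by rw [hΔdef, show v = 0 from funext hv, dotProduct_zero])
    exact Finset.sum_pos' (fun j _ => hterm j)
      ⟨j, Finset.mem_univ j, div_pos (by positivity) (hpos j hj)⟩
  -- The Lagrange minimizer: the displacement is proportional to `v j / a j`, scaled to land on `θ'
  -- ⬝ᵥ v = 0`. Where `a j = 0` also `v j = 0`, and the convention `0 / 0 = 0` leaves that
  -- coordinate in place.
  have hmain := h (fun j => θ j - Δ / S * (v j / a j)) (by
    have : (fun j => θ j - Δ / S * (v j / a j)) ⬝ᵥ v = Δ - Δ / S * S := by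
      rw [hΔdef, hS, dotProduct, dotProduct, Finset.mul_sum, ← Finset.sum_sub_distrib]
      refine Finset.sum_congr rfl fun j _ => ?_
      ring
    rw [this, div_mul_cancel₀ _ hS0.ne', sub_self])
  have hcost : ∑ j, a j * ((θ j - Δ / S * (v j / a j) - θ j) ^ 2 / 2) = Δ ^ 2 / (2 * S) := by
    have : ∀ j, a j * ((θ j - Δ / S * (v j / a j) - θ j) ^ 2 / 2) =
        (Δ / S) ^ 2 / 2 * (v j ^ 2 / a j) := by
      intro j
      by_cases hj : v j = 0
      · simp [hj]
      · have := (hpos j hj).ne'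
        field_simp
        ring
    simp_rw [this]
    rw [← Finset.mul_sum, ← hS]
    field_simp
  rw [hcost, le_div_iff₀ (by positivity)] at hmain
  linarith

/-- Every arm that is optimal for `θ` becomes the unique best arm after a small perturbation. -/
theorem isUniqueBestArm_perturbation {d : ℕ} {𝒳 : Finset (Fin d → ℝ)}
    (h01 : ∀ x ∈ 𝒳, ∀ i, x i = 0 ∨ x i = 1) {θ y : Fin d → ℝ} (hy : y ∈ 𝒳)
    (hmax : ∀ z ∈ 𝒳, θ ⬝ᵥ z ≤ θ ⬝ᵥ y) {ε : ℝ} (hε : 0 < ε) :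
    IsUniqueBestArm 𝒳 (fun i => θ i + ε * (2 * y i - 1)) y := by
  refine ⟨hy, fun z hz hzy => ?_⟩
  have hsplit : ∀ w : Fin d → ℝ, (fun i => θ i + ε * (2 * y i - 1)) ⬝ᵥ w =
      θ ⬝ᵥ w + ε * ∑ i, (2 * y i - 1) * w i := by
    intro w
    rw [dotProduct, dotProduct, Finset.mul_sum, ← Finset.sum_add_distrib]
    exact Finset.sum_congr rfl fun i _ => by ring
  rw [hsplit, hsplit]
  -- The direction `2y - 1` rewards the ones of `y` and penalizes its zeros, so `y` is its only
  -- maximizer among 0/1 vectors.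
  have hle : ∀ i, (2 * y i - 1) * z i ≤ (2 * y i - 1) * y i := fun i => by
    rcases h01 y hy i with h | h <;> rcases h01 z hz i with h' | h' <;> rw [h, h'] <;> norm_num
  obtain ⟨i, hi⟩ := Function.ne_iff.1 hzy
  have hlt : (2 * y i - 1) * z i < (2 * y i - 1) * y i := by
    rcases h01 y hy i with h | h <;> rcases h01 z hz i with h' | h' <;>
      first
      | exact absurd (h'.trans h.symm) hi
      | (rw [h, h']; norm_num)
  exact add_lt_add_of_le_of_lt (hmax z hz) (mul_lt_mul_of_pos_left
    (Finset.sum_lt_sum (fun i _ => hle i) ⟨i, Finset.mem_univ i, hlt⟩) hε)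

/-- For 0/1 arms `x j ^ 2 = x j`, so the diagonal entry is the frequency with which coordinate `j`
is observed. -/
theorem Asemi_apply_self {d : ℕ} {𝒳 : Finset (Fin d → ℝ)}
    (h01 : ∀ x ∈ 𝒳, ∀ i, x i = 0 ∨ x i = 1) (w : 𝒳 → ℝ) (j : Fin d) :
    Asemi 𝒳 w j j = ∑ x : 𝒳, w x * (x : Fin d → ℝ) j := by
  rw [Asemi, Matrix.diagonal_apply_eq, Matrix.diag_apply, Matrix.sum_apply]
  refine Finset.sum_congr rfl fun x _ => ?_
  rcases h01 x x.2 j with h | h <;> simp [Matrix.vecMulVec_apply, h]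

theorem invNormSq_eq_ofReal {d : ℕ} (M : Matrix (Fin d) (Fin d) ℝ) (v : Fin d → ℝ)
    (h : ∀ j, v j ≠ 0 → 0 < M j j) :
    invNormSq M v = ENNReal.ofReal (∑ j, v j ^ 2 / M j j) := by
  have hterm : ∀ j, ENNReal.ofReal (v j ^ 2) / ENNReal.ofReal (M j j) =
      ENNReal.ofReal (v j ^ 2 / M j j) := by
    intro j
    by_cases hj : v j = 0
    · simp [hj]
    · rw [ENNReal.ofReal_div_of_pos (h j hj)]
  rw [invNormSq, ENNReal.ofReal_sum_of_nonneg]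
  · exact Finset.sum_congr rfl fun j _ => hterm j
  · intro j _
    by_cases hj : v j = 0
    · simp [hj]
    · exact div_nonneg (sq_nonneg _) (h j hj).le

theorem rhoStar_of_forall_eq {d : ℕ} {𝒳 : Finset (Fin d → ℝ)} {θ xs : Fin d → ℝ} (hxs : xs ∈ 𝒳)
    (h : ∀ x ∈ 𝒳, x = xs) : rhoStar 𝒳 θ xs = 0 := by
  classical
  refine le_antisymm (iInf₂_le_of_le (Pi.single (⟨xs, hxs⟩ : 𝒳) 1)
    (single_mem_stdSimplex ℝ _) ?_) zero_le
  exact iSup₂_le fun x hx => iSup_le fun hne => absurd (h x hx) hne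

/-! ### Information constraints on the expected observation counts. -/

namespace SemiBanditAlgorithm

variable {d : ℕ} {𝒳 : Finset (Fin d → ℝ)} (A : SemiBanditAlgorithm.{u} 𝒳)

/-- The expected number of observations of the coordinate `j`. -/
noncomputable def expectedObs (θ : Fin d → ℝ) (j : Fin d) : ℝ :=
  ∑ y : 𝒳, (A.expectedPulls θ y).toReal * (y : Fin d → ℝ) j

theorem expectedObs_nonneg (h01 : ∀ x ∈ 𝒳, ∀ i, x i = 0 ∨ x i = 1) (θ : Fin d → ℝ) (j : Fin d) :
    0 ≤ A.expectedObs θ j :=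
  Finset.sum_nonneg fun y _ => mul_nonneg ENNReal.toReal_nonneg
    (by rcases h01 y y.2 j with h | h <;> simp [h])

theorem sum_expectedPulls_mul_semiDivergence (h01 : ∀ x ∈ 𝒳, ∀ i, x i = 0 ∨ x i = 1)
    (θ θ' : Fin d → ℝ) :
    ∑ y : 𝒳, (A.expectedPulls θ y).toReal * semiDivergence θ θ' y =
      ∑ j, A.expectedObs θ j * ((θ' j - θ j) ^ 2 / 2) := by
  simp_rw [expectedObs, Finset.sum_mul, semiDivergence, Finset.mul_sum]
  rw [Finset.sum_comm]
  refine Finset.sum_congr rfl fun j _ => Finset.sum_congr rfl fun y _ => ?_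
  rcases h01 y y.2 j with h | h <;> simp [h]

theorem law_returns_le_of_ne {δ : ℝ} {θ x y : Fin d → ℝ} (hA : A.IsPAC δ)
    (hy : IsUniqueBestArm 𝒳 θ y) (hxy : x ≠ y) : (A.law θ).real (A.returns x) ≤ δ := by
  have hdisj : Disjoint (A.returns x) (A.returns y) := by
    refine Set.disjoint_left.2 fun ω h1 h2 => ?_
    obtain ⟨s, hs, hx⟩ := h1
    obtain ⟨t, ht, hy⟩ := h2
    have : s = t := by exact_mod_cast hs.symm.trans ht
    subst this
    exact hxy (hx.symm.trans hy)
  have h1 : 1 - δ ≤ (A.law θ).real (A.returns y) :=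
    (ENNReal.ofReal_le_iff_le_toReal (measure_ne_top _ _)).1 (hA θ y hy)
  have h2 := measureReal_union (μ := A.law θ) hdisj (A.measurableSet_returns y)
  have h3 : (A.law θ).real (A.returns x ∪ A.returns y) ≤ 1 := measureReal_le_one
  linarith

/-- The information constraint imposed by an alternative `θ'` for which `xs` is not the unique
best arm. -/
theorem le_expectedObs_cost (h01 : ∀ x ∈ 𝒳, ∀ i, x i = 0 ∨ x i = 1) {θ xs : Fin d → ℝ}
    (hxs : IsUniqueBestArm 𝒳 θ xs) {δ : ℝ} (hδ : 0 < δ) (hδ2 : δ < 1 / 2) (hA : A.IsPAC δ)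
    (hfin : ∫⁻ ω, (A.numPulls ω : ℝ≥0∞) ∂A.law θ ≠ ∞) {x : Fin d → ℝ} (hx : x ∈ 𝒳) (hne : x ≠ xs)
    {θ' : Fin d → ℝ} (hθ' : θ' ⬝ᵥ xs ≤ θ' ⬝ᵥ x) :
    (1 - 2 * δ) * Real.log ((1 - δ) / δ) ≤
      ∑ j, A.expectedObs θ j * ((θ' j - θ j) ^ 2 / 2) := by
  -- Some maximizer for `θ'` differs from `xs`: if `xs` is itself a maximizer, then `x` ties with
  -- it.
  obtain ⟨y, hy, hyne, hmax⟩ : ∃ y ∈ 𝒳, y ≠ xs ∧ ∀ z ∈ 𝒳, θ' ⬝ᵥ z ≤ θ' ⬝ᵥ y := by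
    obtain ⟨m, hm, hmax⟩ := 𝒳.exists_max_image (fun z => θ' ⬝ᵥ z) ⟨x, hx⟩
    by_cases hmx : m = xs
    · subst hmx
      exact ⟨x, hx, hne, fun z hz => (hmax z hz).trans hθ'⟩
    · exact ⟨m, hm, hmx, hmax⟩
  have hret : 1 - δ ≤ (A.law θ).real (A.returns xs) :=
    (ENNReal.ofReal_le_iff_le_toReal (measure_ne_top _ _)).1 (hA θ xs hxs)
  -- The PAC property says nothing about `θ'` if its best arm is tied. The bound is proved for
  -- perturbations having `y` as unique best arm, and continuity of the cost lets `ε` tend to `0`.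
  have hε : ∀ ε : ℝ, 0 < ε → (1 - 2 * δ) * Real.log ((1 - δ) / δ) ≤
      ∑ j, A.expectedObs θ j * ((θ' j + ε * (2 * y j - 1) - θ j) ^ 2 / 2) := by
    intro ε hε
    rw [← A.sum_expectedPulls_mul_semiDivergence h01 θ fun j => θ' j + ε * (2 * y j - 1)]
    exact A.transportation θ _ xs hδ hδ2 hfin hret
      (A.law_returns_le_of_ne hA (isUniqueBestArm_perturbation h01 hy hmax hε) hyne.symm)
  have hcont : Continuous fun ε : ℝ =>
      ∑ j, A.expectedObs θ j * ((θ' j + ε * (2 * y j - 1) - θ j) ^ 2 / 2) := by fun_prop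
  have hlim := (hcont.tendsto 0).mono_left (nhdsWithin_le_nhds (s := Set.Ioi 0))
  simp only [zero_mul, add_zero] at hlim
  exact ge_of_tendsto hlim (Filter.eventually_of_mem self_mem_nhdsWithin hε)

end SemiBanditAlgorithm

/-! ### Normalizing the pull counts and concluding. -/

theorem mainTheorem7 {d : ℕ} (𝒳 : Finset (Fin d → ℝ))
    (h01 : ∀ x ∈ 𝒳, ∀ i, x i = 0 ∨ x i = 1)
    (θ xs : Fin d → ℝ) (hxs : IsUniqueBestArm 𝒳 θ xs)
    (δ : ℝ) (hδ0 : 0 < δ) (hδ1 : δ < 1)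
    (A : SemiBanditAlgorithm.{u} 𝒳) (hA : A.IsPAC δ) :
    ENNReal.ofReal (Real.log (1 / (2.4 * δ))) * rhoStar 𝒳 θ xs
      ≤ ∫⁻ ω, (A.numPulls ω : ℝ≥0∞) ∂(A.law θ) := by
  rcases le_or_gt 1 (2.4 * δ) with hδ | hδ
  · rw [ENNReal.ofReal_of_nonpos
      (Real.log_nonpos (by positivity) (div_le_one_of_le₀ hδ (by positivity))), zero_mul]
    exact zero_le
  rcases eq_or_ne (∫⁻ ω, (A.numPulls ω : ℝ≥0∞) ∂A.law θ) ∞ with hfin | hfin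
  · rw [hfin]
    exact le_top
  by_cases hsingle : ∀ x ∈ 𝒳, x = xs
  · rw [rhoStar_of_forall_eq hxs.1 hsingle, mul_zero]
    exact zero_le
  push Not at hsingle
  obtain ⟨x₀, hx₀, hx₀ne⟩ := hsingle
  set κ := Real.log (1 / (2.4 * δ)) with hκ
  set K := (1 - 2 * δ) * Real.log ((1 - δ) / δ) with hK
  have hκ0 : 0 < κ := Real.log_pos ((one_lt_div (by positivity)).2 hδ)
  have hκK : κ ≤ 2 * K := log_le_two_mul_binary_divergence hδ0 hδ
  set a := A.expectedObs θ with ha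
  have hkey : ∀ x ∈ 𝒳, x ≠ xs → 0 < θ ⬝ᵥ (xs - x) ∧ (∀ j, (xs - x) j ≠ 0 → 0 < a j) ∧
      2 * K * ∑ j, (xs - x) j ^ 2 / a j ≤ (θ ⬝ᵥ (xs - x)) ^ 2 := by
    intro x hx hne
    have hΔ : 0 < θ ⬝ᵥ (xs - x) := by
      rw [dotProduct_sub]
      exact sub_pos.2 (hxs.2 x hx hne)
    refine ⟨hΔ, diagonal_cost_lower_bound (A.expectedObs_nonneg h01 θ) (by linarith) hΔ ?_⟩
    intro θ' hθ'
    rw [dotProduct_sub, sub_nonpos] at hθ'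
    exact A.le_expectedObs_cost h01 hxs hδ0 (by linarith) hA hfin hx hne hθ'
  set N : 𝒳 → ℝ := fun y => (A.expectedPulls θ y).toReal with hN
  set n := ∑ y, N y with hn
  have hnT : ∫⁻ ω, (A.numPulls ω : ℝ≥0∞) ∂A.law θ = ENNReal.ofReal n := by
    rw [A.lintegral_numPulls] at hfin ⊢
    rw [hn, hN, ← ENNReal.toReal_sum fun y hy => ENNReal.sum_ne_top.1 hfin y hy,
      ENNReal.ofReal_toReal hfin]
  have hN0 : ∀ y, 0 ≤ N y := fun y => ENNReal.toReal_nonneg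
  -- With no pulls every `a j` would vanish, yet a coordinate separating `x₀` from `xs` must be
  -- observed.
  have hn0 : 0 < n := by
    refine (Finset.sum_nonneg fun y _ => hN0 y).lt_of_ne fun h0 => ?_
    have hzero := (Finset.sum_eq_zero_iff_of_nonneg fun y _ => hN0 y).1 h0.symm
    obtain ⟨j, hj⟩ := Function.ne_iff.1 hx₀ne
    have := (hkey x₀ hx₀ hx₀ne).2.1 j (by simpa [sub_eq_zero] using hj.symm)
    refine this.ne' (Finset.sum_eq_zero fun y hy => ?_)
    rw [show (A.expectedPulls θ y).toReal = 0 from hzero y hy, zero_mul]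
  -- The candidate for the infimum in `rhoStar`: the expected proportions of pulls made by the
  -- algorithm.
  have hw : (fun y => N y / n) ∈ stdSimplex ℝ 𝒳 :=
    ⟨fun y => div_nonneg (hN0 y) hn0.le, by rw [← Finset.sum_div, ← hn, div_self hn0.ne']⟩
  have hdiag : ∀ j, Asemi 𝒳 (fun y => N y / n) j j = a j / n := by
    intro j
    rw [Asemi_apply_self h01, ha, SemiBanditAlgorithm.expectedObs, Finset.sum_div]
    exact Finset.sum_congr rfl fun y _ => by ring
  have hrho : rhoStar 𝒳 θ xs ≤ ENNReal.ofReal (n / κ) := by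
    refine iInf₂_le_of_le _ hw (iSup₂_le fun x hx => iSup_le fun hne => ?_)
    obtain ⟨hΔ, hpos, hle⟩ := hkey x hx hne
    rw [invNormSq_eq_ofReal _ _ fun j hj => by rw [hdiag]; exact div_pos (hpos j hj) hn0,
      ← ENNReal.ofReal_div_of_pos (by positivity)]
    refine ENNReal.ofReal_le_ofReal ?_
    have hsum : ∑ j, (xs - x) j ^ 2 / Asemi 𝒳 (fun y => N y / n) j j =
        n * ∑ j, (xs - x) j ^ 2 / a j := by
      rw [Finset.mul_sum]
      refine Finset.sum_congr rfl fun j _ => ?_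
      rw [hdiag, div_div_eq_mul_div]
      ring
    have hS : 0 ≤ ∑ j, (xs - x) j ^ 2 / a j :=
      Finset.sum_nonneg fun j _ => div_nonneg (sq_nonneg _) (A.expectedObs_nonneg h01 θ j)
    rw [hsum, div_le_div_iff₀ (by positivity) hκ0, mul_assoc]
    refine mul_le_mul_of_nonneg_left ?_ hn0.le
    rw [mul_comm]
    exact (mul_le_mul_of_nonneg_right hκK hS).trans hle
  calc ENNReal.ofReal κ * rhoStar 𝒳 θ xs
      ≤ ENNReal.ofReal κ * ENNReal.ofReal (n / κ) := by gcongr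
    _ = ENNReal.ofReal n := by
        rw [← ENNReal.ofReal_mul hκ0.le, mul_div_cancel₀ _ hκ0.ne']
    _ = _ := hnT.symm
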